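/- Let $d\ge 0$, and let $h:\mathbb{R}^d\to\mathbb{R}$ be continuous, integrable and positive semi-definite (i.e. for all finite families $x_1,\dots,x_n\in\mathbb{R}^d$ the matrix $(h(x_i-x_j))_{i,j}$ is symmetric positive semi-definite), with $h(\tau)>0$ for all $\tau\in\mathbb{R}^d$ and $h(0)=1$. Let $K\ge 1$, and for $k=1,\dots,K$ let $\sigma_k>0$, $\gamma_k\in(0,\infty)^d$ and $\omega_k\in\mathbb{R}^d$. Consider the stationary generalized spectral kernel $$\kappa(\tau)=\sum_{k=1}^{K}\sigma_k^2\,h(\tau\odot\gamma_k)\cos(2\pi\,\omega_k^T\tau),\qquad \tau\in\mathbb{R}^d,$$ where $\odot$ is the elementwise product. Let $X=(X_t)_{t\in\mathbb{R}^d}$ and $Y=(Y_t)_{t\in\mathbb{R}^d}$ be real-valued mean-zero stationary Gaussian processes, on possibly different probability spaces, with $\operatorname{Cov}(X_s,X_t)=\kappa(s-t)$ and $\operatorname{Cov}(Y_s,Y_t)=h(s-t)$ for all $s,t\in\mathbb{R}^d$. Then for every integer $p\ge 0$, $X$ is $p$ times continuously differentiable in the mean-square sense if and only if $Y$ is. Here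 a process $(Z_t)_{t\in\mathbb{R}^d}$ of square-integrable random variables is called $p$ times continuously differentiable in the mean-square sense if all its iterated partial derivatives up to order $p$ exist as limits of difference quotients in $L^2$ at every point and, together with $Z$ itself, are continuous as functions of $t$ with values in $L^2$. -/

import Mathlib

open MeasureTheory ProbabilityTheory Filter Topology

noncomputable section

namespace SpectralKernel

/-- The elementwise product of two vectors of `ℝ^d`. -/
def hprod {d : ℕ} (x y : EuclideanSpace ℝ (Fin d)) : EuclideanSpace ℝ (Fin d) :=
  WithLp.toLp 2 (fun j => x j * y j)

/-- `h` is a real-valued stationary kernel: all matrices `(h (x i - x j))` are symmetric and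
positive semi-definite (`Matrix.PosSemidef` includes the symmetry). -/
def IsPSDFunction {d : ℕ} (h : EuclideanSpace ℝ (Fin d) → ℝ) : Prop :=
  ∀ (n : ℕ) (x : Fin n → EuclideanSpace ℝ (Fin d)),
    (Matrix.of fun i j : Fin n => h (x i - x j)).PosSemidef

/-- The function
`τ ↦ ∑ k, σ k ^ 2 * h (τ ⊙ γ k) * cos (2 π ⟨ω k, τ⟩)`. -/
def gsk {d K : ℕ} (h : EuclideanSpace ℝ (Fin d) → ℝ) (σ : Fin K → ℝ)
    (γ ω : Fin K → EuclideanSpace ℝ (Fin d)) (τ : EuclideanSpace ℝ (Fin d)) : ℝ :=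
  ∑ k, σ k ^ 2 * h (hprod τ (γ k)) * Real.cos (2 * Real.pi * inner ℝ (ω k) τ)

/-- `X` is a mean-zero stationary Gaussian process on `ℝ^d` with covariance function
`(s, t) ↦ c (s - t)`. (Since the mean is constant and the covariance depends only on `s - t`,
the Gaussian process is stationary, in the weak and hence in the strict sense.) -/
structure IsStationaryGP {d : ℕ} {Ω : Type*} [MeasurableSpace Ω]
    (X : EuclideanSpace ℝ (Fin d) → Ω → ℝ) (c : EuclideanSpace ℝ (Fin d) → ℝ)
    (P : Measure Ω) : Prop where
  gaussian : IsGaussianProcess X P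
  mean_zero : ∀ t, ∫ a, X t a ∂P = 0
  cov_eq : ∀ s t, covariance (X s) (X t) P = c (s - t)

/-- Mean-square continuity of a second-order process on `ℝ^d`. -/
def IsMSContinuous {d : ℕ} {Ω : Type*} [MeasurableSpace Ω] (P : Measure Ω)
    (X : EuclideanSpace ℝ (Fin d) → Ω → ℝ) : Prop :=
  (∀ t, MemLp (X t) 2 P) ∧
    ∀ t, Tendsto (fun s => eLpNorm (fun a => X s a - X t a) 2 P) (𝓝 t) (𝓝 0)

/-- The process `Z` is the mean-square partial derivative of `X` in the `j`-th coordinate: at each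
`t`, the difference quotients of `X` converge to `Z t` in `L²(P)`. -/
def IsMSPartialDeriv {d : ℕ} {Ω : Type*} [MeasurableSpace Ω] (P : Measure Ω) (j : Fin d)
    (X Z : EuclideanSpace ℝ (Fin d) → Ω → ℝ) : Prop :=
  ∀ t, Tendsto
    (fun ε : ℝ =>
      eLpNorm (fun a => (X (t + ε • EuclideanSpace.single j 1) a - X t a) / ε - Z t a) 2 P)
    (𝓝[≠] 0) (𝓝 0)

/-- `X` is `p` times continuously differentiable in the mean-square sense: all its iterated
mean-square partial derivatives up to order `p` exist and are mean-square continuous. -/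
def IsMSContDiff {d : ℕ} {Ω : Type*} [MeasurableSpace Ω] (P : Measure Ω) :
    ℕ → (EuclideanSpace ℝ (Fin d) → Ω → ℝ) → Prop
  | 0, X => IsMSContinuous P X
  | p + 1, X => IsMSContinuous P X ∧
      ∀ j : Fin d, ∃ Z : EuclideanSpace ℝ (Fin d) → Ω → ℝ,
        IsMSPartialDeriv P j X Z ∧ IsMSContDiff P p Z

end SpectralKernel

end

/-!
Mean-square calculus of a second-order process is ordinary calculus of the curve `t ↦ X t` in
`L²(P)`, and since continuous partial derivatives give continuous differentiability, `X` is `p`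
times continuously mean-square differentiable iff this curve is `C^p`. Being `C^p` depends only on
the Gram kernel: two families in Hilbert spaces with the same Gram kernel are images of each other
under continuous linear maps. So `X` may be replaced by any family with Gram kernel `κ`, and
`t ↦ (σ k cos (2π⟨ω k, t⟩) Y (t ⊙ γ k), σ k sin (2π⟨ω k, t⟩) Y (t ⊙ γ k))_k` is one. It is `C^p`
if `Y` is, and conversely `cos² + sin² = 1` recovers `Y (t ⊙ γ k)` from a single pair.
-/

open Asymptotics
open scoped InnerProductSpace

namespace SpectralKernel

section LineDeriv

variable {E F : Type*} [NormedAddCommGroup E] [NormedSpace ℝ E] [NormedAddCommGroup F]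
  [NormedSpace ℝ F]

theorem hasDerivAt_comp_add_smul {u : E → F} {x v : E} {r : ℝ} {z : F}
    (hu : HasLineDerivAt ℝ u z (x + r • v) v) : HasDerivAt (fun s : ℝ => u (x + s • v)) z r := by
  have hshift : HasDerivAt (fun s : ℝ => u (x + r • v + s • v)) z (r - r) := by
    rwa [sub_self]
  simpa only [add_assoc, ← add_smul, add_sub_cancel] using hshift.comp_sub_const r r

theorem isLittleO_increment_of_hasLineDerivAt {u z : E → F} {x v : E}
    (hu : ∀ᶠ y in 𝓝 x, HasLineDerivAt ℝ u (z y) y v) (hz : ContinuousAt z x) :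
    (fun q : E × ℝ => u (q.1 + q.2 • v) - u q.1 - q.2 • z x) =o[𝓝 (x, 0)] Prod.snd := by
  refine isLittleO_iff.2 fun ε hε => ?_
  have htranslate : Tendsto (fun q : (E × ℝ) × ℝ => q.1.1 + q.2 • v)
      (𝓝 (x, 0) ×ˢ 𝓝 0) (𝓝 x) := by
    rw [← nhds_prod_eq]
    exact Continuous.tendsto' (by fun_prop) _ _ (by simp)
  have hclose : ∀ᶠ y in 𝓝 x, ‖z y - z x‖ ≤ ε := by
    simpa only [← dist_eq_norm] using hz.eventually (Metric.closedBall_mem_nhds _ hε)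
  have hsegment := (htranslate.eventually (hu.and hclose)).segment_of_prod_nhds
    (r := fun q r => HasLineDerivAt ℝ u (z (q.1 + r • v)) (q.1 + r • v) v ∧
      ‖z (q.1 + r • v) - z x‖ ≤ ε) tendsto_const_nhds continuousAt_snd
  filter_upwards [hsegment] with q hq
  have hderiv : ∀ r ∈ segment ℝ 0 q.2, HasDerivWithinAt (fun r => u (q.1 + r • v) - r • z x)
      (z (q.1 + r • v) - z x) (segment ℝ 0 q.2) r := fun r hr =>
    ((hasDerivAt_comp_add_smul (hq r hr).1).sub
      (by simpa using (hasDerivAt_id r).smul_const (z x))).hasDerivWithinAt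
  simpa [sub_right_comm] using
    (convex_segment (0 : ℝ) q.2).norm_image_sub_le_of_norm_hasDerivWithin_le hderiv
      (fun r hr => (hq r hr).2) (left_mem_segment ..) (right_mem_segment ..)

theorem isLittleO_increment_sum_of_hasLineDerivAt {ι : Type*} [Fintype ι] (s : Finset ι)
    {u : E → F} {z : ι → E → F} {x : E} {v : ι → E}
    (hu : ∀ i, ∀ᶠ y in 𝓝 x, HasLineDerivAt ℝ u (z i y) y (v i))
    (hz : ∀ i, ContinuousAt (z i) x) :
    (fun q : E × (ι → ℝ) => u (q.1 + ∑ i ∈ s, q.2 i • v i) - u q.1 - ∑ i ∈ s, q.2 i • z i x)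
      =o[𝓝 (x, 0)] Prod.snd := by
  classical
  induction s using Finset.induction_on with
  | empty => simp
  | insert i s hi ih =>
    have hpath : Tendsto (fun q : E × (ι → ℝ) => (q.1 + ∑ j ∈ s, q.2 j • v j, q.2 i))
        (𝓝 (x, 0)) (𝓝 (x, 0)) := Continuous.tendsto' (by fun_prop) _ _ (by simp)
    have hcoord : (fun q : E × (ι → ℝ) => q.2 i) =O[𝓝 (x, 0)] Prod.snd :=
      .of_bound' <| .of_forall fun q => norm_le_pi_norm q.2 i
    have hlast := ((isLittleO_increment_of_hasLineDerivAt (hu i) (hz i)).comp_tendsto hpath)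
      |>.trans_isBigO hcoord
    refine (hlast.add ih).congr_left fun q => ?_
    simp only [Function.comp_apply, Finset.sum_insert hi, add_assoc, add_comm (q.2 i • v i)]
    abel

theorem hasStrictFDerivAt_of_hasLineDerivAt_basis {ι : Type*} [Finite ι] (b : Module.Basis ι ℝ E)
    {u : E → F} {z : ι → E → F} {x : E}
    (hu : ∀ i, ∀ᶠ y in 𝓝 x, HasLineDerivAt ℝ u (z i y) y (b i))
    (hz : ∀ i, ContinuousAt (z i) x) :
    HasStrictFDerivAt u (b.constrL fun i => z i x) x := by
  have := Fintype.ofFinite ι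
  have hcoord : Tendsto (fun q : E × E => (q.2, b.equivFunL (q.1 - q.2))) (𝓝 (x, x))
      (𝓝 (x, 0)) := Continuous.tendsto' (by fun_prop) _ _ (by simp)
  have hincrement := ((isLittleO_increment_sum_of_hasLineDerivAt Finset.univ hu hz).comp_tendsto
    hcoord).trans_isBigO (b.equivFunL.isBigO_comp _ _)
  refine .of_isLittleO <| hincrement.congr_left fun q => ?_
  have hrepr : ∑ i, b.equivFunL (q.1 - q.2) i • b i = q.1 - q.2 := b.sum_equivFun _
  simp only [Function.comp_apply, hrepr, add_sub_cancel, b.constrL_apply]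
  rfl

theorem contDiff_succ_iff_hasLineDerivAt_basis {ι : Type*} [Finite ι] (b : Module.Basis ι ℝ E)
    {u : E → F} {n : ℕ} :
    ContDiff ℝ (n + 1) u ↔
      ∀ i, ∃ z : E → F, (∀ x, HasLineDerivAt ℝ u (z x) x (b i)) ∧ ContDiff ℝ n z := by
  refine ⟨fun hu i => ⟨fun x => fderiv ℝ u x (b i), fun x =>
    (hu.differentiable (by simp) x).hasFDerivAt.hasLineDerivAt (b i), ?_⟩, fun hu => ?_⟩
  · exact (hu.fderiv_right le_rfl).clm_apply contDiff_const
  · have := Fintype.ofFinite ι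
    choose z hz hzn using hu
    refine contDiff_succ_iff_hasFDerivAt.2 ⟨fun x => b.constrL fun i => z i x, ?_, fun x =>
      (hasStrictFDerivAt_of_hasLineDerivAt_basis b (fun i => .of_forall (hz i)) fun i =>
        (hzn i).continuous.continuousAt).hasFDerivAt⟩
    have := Module.Finite.of_basis b
    refine contDiff_clm_apply_iff.2 fun y => ?_
    simp only [b.constrL_apply]
    exact .sum fun i _ => (hzn i).const_smul _

end LineDeriv

section Gram

variable {𝕜 ι H H' : Type*} [RCLike 𝕜] [NormedAddCommGroup H] [InnerProductSpace 𝕜 H]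
  [NormedAddCommGroup H'] [InnerProductSpace 𝕜 H'] {u : ι → H} {v : ι → H'}

theorem norm_linearCombination_eq_of_inner_eq (huv : ∀ s t, ⟪u s, u t⟫_𝕜 = ⟪v s, v t⟫_𝕜)
    (a : ι →₀ 𝕜) : ‖Finsupp.linearCombination 𝕜 u a‖ = ‖Finsupp.linearCombination 𝕜 v a‖ := by
  simp only [norm_eq_sqrt_re_inner (𝕜 := 𝕜), Finsupp.linearCombination_apply, Finsupp.sum,
    sum_inner, inner_sum, inner_smul_left, inner_smul_right, huv]

theorem exists_continuousLinearMap_of_inner_eq [CompleteSpace H] [CompleteSpace H']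
    (huv : ∀ s t, ⟪u s, u t⟫_𝕜 = ⟪v s, v t⟫_𝕜) : ∃ T : H →L[𝕜] H', ∀ t, T (u t) = v t := by
  let U := Finsupp.linearCombination 𝕜 u
  let V := Finsupp.linearCombination 𝕜 v
  let S := (LinearMap.range U).topologicalClosure
  let e : (ι →₀ 𝕜) →ₗ[𝕜] S :=
    U.codRestrict S fun a => (LinearMap.range U).le_topologicalClosure ⟨a, rfl⟩
  have hdense : DenseRange e :=
    ((denseRange_inclusion_iff subset_closure).2 subset_rfl).comp
      U.surjective_rangeRestrict.denseRange (continuous_inclusion subset_closure)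
  have hbound : ∀ a, ‖V a‖ ≤ 1 * ‖e a‖ := fun a => by
    rw [one_mul]
    exact (norm_linearCombination_eq_of_inner_eq huv a).ge
  have : CompleteSpace S := (Submodule.isClosed_topologicalClosure _).completeSpace_coe
  refine ⟨V.extendOfNorm e ∘L S.orthogonalProjectionOnto, fun t => ?_⟩
  have hu : u t = (e (Finsupp.single t 1) : S) := by simp [e, U]
  have hv : V (Finsupp.single t 1) = v t := by simp [V]
  rw [ContinuousLinearMap.comp_apply, hu, Submodule.orthogonalProjectionOnto_mem_subspace_eq_self,
    LinearMap.extendOfNorm_eq hdense ⟨1, hbound⟩, hv]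

theorem contDiff_iff_of_inner_eq [CompleteSpace H] [CompleteSpace H'] {E : Type*}
    [NormedAddCommGroup E] [NormedSpace 𝕜 E] {u : E → H} {v : E → H'}
    (huv : ∀ s t, ⟪u s, u t⟫_𝕜 = ⟪v s, v t⟫_𝕜) (n : WithTop ℕ∞) :
    ContDiff 𝕜 n u ↔ ContDiff 𝕜 n v := by
  obtain ⟨T, hT⟩ := exists_continuousLinearMap_of_inner_eq huv
  obtain ⟨T', hT'⟩ := exists_continuousLinearMap_of_inner_eq fun s t => (huv s t).symm
  exact ⟨fun hu => by simpa only [Function.comp_def, hT] using T.contDiff.comp hu,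
    fun hv => by simpa only [Function.comp_def, hT'] using T'.contDiff.comp hv⟩

end Gram

section MeanSquare

variable {d : ℕ} {Ω : Type*} [MeasurableSpace Ω] {P : Measure Ω}
  {X : EuclideanSpace ℝ (Fin d) → Ω → ℝ}

theorem IsMSContDiff.memLp {p : ℕ} (hX : IsMSContDiff P p X) (t : EuclideanSpace ℝ (Fin d)) :
    MemLp (X t) 2 P := by
  cases p with
  | zero => exact hX.1 t
  | succ p => exact hX.1.1 t

theorem isMSContinuous_iff_continuous_toLp (hX : ∀ t, MemLp (X t) 2 P) :
    IsMSContinuous P X ↔ Continuous fun t => (hX t).toLp (X t) := by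
  rw [IsMSContinuous, and_iff_right hX, continuous_iff_continuousAt]
  exact forall_congr' fun t => (Lp.tendsto_Lp_iff_tendsto_eLpNorm'' X hX (X t) (hX t)).symm

theorem isMSPartialDeriv_iff_hasLineDerivAt_toLp {Z : EuclideanSpace ℝ (Fin d) → Ω → ℝ}
    (hX : ∀ t, MemLp (X t) 2 P) (hZ : ∀ t, MemLp (Z t) 2 P) (j : Fin d) :
    IsMSPartialDeriv P j X Z ↔ ∀ t, HasLineDerivAt ℝ (fun t => (hX t).toLp (X t))
      ((hZ t).toLp (Z t)) t (EuclideanSpace.single j 1) := by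
  refine forall_congr' fun t => ?_
  have hquotient : ∀ (ε : ℝ) (a : Ω),
      (X (t + ε • EuclideanSpace.single j 1) a - X t a) / ε - Z t a =
        (ε⁻¹ • (X (t + ε • EuclideanSpace.single j 1) - X t) - Z t) a := fun ε a => by
    simp [div_eq_inv_mul]
  simp only [hquotient, hasLineDerivAt_iff_tendsto_slope_zero]
  exact (Lp.tendsto_Lp_iff_tendsto_eLpNorm'' _
    (fun ε => ((hX _).sub (hX t)).const_smul ε⁻¹) (Z t) (hZ t)).symm

theorem isMSContDiff_iff_contDiff_toLp (p : ℕ) (hX : ∀ t, MemLp (X t) 2 P) :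
    IsMSContDiff P p X ↔ ContDiff ℝ p fun t => (hX t).toLp (X t) := by
  induction p generalizing X with
  | zero =>
    rw [Nat.cast_zero, contDiff_zero]
    exact isMSContinuous_iff_continuous_toLp hX
  | succ p ih =>
    have hpartials := contDiff_succ_iff_hasLineDerivAt_basis
      (EuclideanSpace.basisFun (Fin d) ℝ).toBasis (u := fun t => (hX t).toLp (X t)) (n := p)
    simp only [OrthonormalBasis.coe_toBasis, EuclideanSpace.basisFun_apply] at hpartials
    rw [Nat.cast_add_one]
    constructor
    · rintro ⟨-, hZ⟩
      refine hpartials.2 fun j => ?_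
      obtain ⟨Z, hXZ, hZp⟩ := hZ j
      exact ⟨_, (isMSPartialDeriv_iff_hasLineDerivAt_toLp hX hZp.memLp j).1 hXZ,
        (ih hZp.memLp).1 hZp⟩
    · refine fun hu => ⟨(isMSContinuous_iff_continuous_toLp hX).2 hu.continuous, fun j => ?_⟩
      obtain ⟨z, hz, hzp⟩ := hpartials.1 hu j
      have hz_memLp : ∀ t, MemLp (z t) 2 P := fun t => Lp.memLp (z t)
      refine ⟨fun t => z t, (isMSPartialDeriv_iff_hasLineDerivAt_toLp hX hz_memLp j).2 ?_,
        (ih hz_memLp).2 ?_⟩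
      · simpa only [Lp.toLp_coeFn] using hz
      · simpa only [Lp.toLp_coeFn] using hzp

theorem inner_toLp {𝕜 F : Type*} [RCLike 𝕜] [NormedAddCommGroup F] [InnerProductSpace 𝕜 F]
    {f g : Ω → F} (hf : MemLp f 2 P) (hg : MemLp g 2 P) :
    ⟪hf.toLp f, hg.toLp g⟫_𝕜 = ∫ a, ⟪f a, g a⟫_𝕜 ∂P := by
  rw [L2.inner_def]
  refine integral_congr_ae ?_
  filter_upwards [hf.coeFn_toLp, hg.coeFn_toLp] with a haf hag
  rw [haf, hag]

variable {c : EuclideanSpace ℝ (Fin d) → ℝ}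

theorem IsStationaryGP.memLp_two (hX : IsStationaryGP X c P) (t : EuclideanSpace ℝ (Fin d)) :
    MemLp (X t) 2 P :=
  (hX.gaussian.hasGaussianLaw_eval t).memLp_two

theorem IsStationaryGP.integral_mul [IsProbabilityMeasure P] (hX : IsStationaryGP X c P)
    (s t : EuclideanSpace ℝ (Fin d)) : ∫ a, X s a * X t a ∂P = c (s - t) := by
  rw [← hX.cov_eq, covariance_eq_sub (hX.memLp_two s) (hX.memLp_two t), hX.mean_zero, zero_mul,
    sub_zero]
  rfl

end MeanSquare

section Modulation

variable {E H : Type*} [NormedAddCommGroup E] [InnerProductSpace ℝ E] [NormedAddCommGroup H]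
  [InnerProductSpace ℝ H]

/-- The pair of the in-phase and quadrature modulations of `w` at frequency `ω`. Its Gram kernel is
that of `w` multiplied by `cos (2 π ⟨ω, s - t⟩)`, and the `L²` product keeps it in a Hilbert
space. -/
noncomputable def modulation (ω : E) (w : E → H) (t : E) : WithLp 2 (H × H) :=
  WithLp.toLp 2 (Real.cos (2 * Real.pi * ⟪ω, t⟫_ℝ) • w t, Real.sin (2 * Real.pi * ⟪ω, t⟫_ℝ) • w t)

theorem inner_modulation (ω : E) (w : E → H) (s t : E) :
    ⟪modulation ω w s, modulation ω w t⟫_ℝ =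
      ⟪w s, w t⟫_ℝ * Real.cos (2 * Real.pi * ⟪ω, s - t⟫_ℝ) := by
  simp only [modulation, WithLp.prod_inner_apply, real_inner_smul_left, real_inner_smul_right,
    inner_sub_right, mul_sub, Real.cos_sub]
  ring

theorem cos_smul_modulation_add_sin_smul_modulation (ω : E) (w : E → H) (t : E) :
    Real.cos (2 * Real.pi * ⟪ω, t⟫_ℝ) • (modulation ω w t).fst +
      Real.sin (2 * Real.pi * ⟪ω, t⟫_ℝ) • (modulation ω w t).snd = w t := by
  simp only [modulation, WithLp.toLp_fst, WithLp.toLp_snd, smul_smul, ← add_smul, ← sq,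
    Real.cos_sq_add_sin_sq, one_smul]

theorem contDiff_modulation_iff (ω : E) {w : E → H} {n : WithTop ℕ∞} :
    ContDiff ℝ n (modulation ω w) ↔ ContDiff ℝ n w := by
  have hcos : ContDiff ℝ n fun t : E => Real.cos (2 * Real.pi * ⟪ω, t⟫_ℝ) :=
    (contDiff_const.mul (contDiff_const.inner ℝ contDiff_id)).cos
  have hsin : ContDiff ℝ n fun t : E => Real.sin (2 * Real.pi * ⟪ω, t⟫_ℝ) :=
    (contDiff_const.mul (contDiff_const.inner ℝ contDiff_id)).sin
  refine ⟨fun hw => ?_, fun hw => WithLp.contDiff_toLp.comp ((hcos.smul hw).prodMk (hsin.smul hw))⟩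
  have hpair := WithLp.contDiff_ofLp.comp hw
  rw [← funext (cos_smul_modulation_add_sin_smul_modulation ω w)]
  exact (hcos.smul hpair.fst).add (hsin.smul hpair.snd)

end Modulation

section HProd

variable {d : ℕ} {F : Type*} [NormedAddCommGroup F] [NormedSpace ℝ F]

theorem hprod_sub_left (s t γ : EuclideanSpace ℝ (Fin d)) :
    hprod (s - t) γ = hprod s γ - hprod t γ := by
  ext j
  simp [hprod, sub_mul]

theorem contDiff_comp_hprod {v : EuclideanSpace ℝ (Fin d) → F} {n : WithTop ℕ∞}
    (hv : ContDiff ℝ n v) (γ : EuclideanSpace ℝ (Fin d)) :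
    ContDiff ℝ n fun t => v (hprod t γ) :=
  hv.comp (g := v) (by unfold hprod; fun_prop)

theorem contDiff_comp_hprod_iff {γ : EuclideanSpace ℝ (Fin d)} (hγ : ∀ j, γ j ≠ 0)
    {v : EuclideanSpace ℝ (Fin d) → F} {n : WithTop ℕ∞} :
    ContDiff ℝ n (fun t => v (hprod t γ)) ↔ ContDiff ℝ n v := by
  refine ⟨fun hv => ?_, fun hv => contDiff_comp_hprod hv γ⟩
  have hcancel : ∀ t, hprod (hprod t (WithLp.toLp 2 fun j => (γ j)⁻¹)) γ = t := fun t => by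
    ext j
    simp [hprod, hγ j]
  simpa only [hcancel] using contDiff_comp_hprod hv (WithLp.toLp 2 fun j => (γ j)⁻¹)

end HProd

section SpectralFamily

variable {d K : ℕ} {H : Type*} [NormedAddCommGroup H] [InnerProductSpace ℝ H]

/-- The feature map of the generalized spectral kernel: applied to a family `v` with Gram kernel
`h (s - t)`, it gives a family with Gram kernel `gsk h σ γ ω (s - t)`. -/
noncomputable def spectralFamily (σ : Fin K → ℝ) (γ ω : Fin K → EuclideanSpace ℝ (Fin d))
    (v : EuclideanSpace ℝ (Fin d) → H) (t : EuclideanSpace ℝ (Fin d)) :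
    PiLp 2 fun _ : Fin K => WithLp 2 (H × H) :=
  WithLp.toLp 2 fun k => σ k • modulation (ω k) (fun s => v (hprod s (γ k))) t

theorem inner_spectralFamily (σ : Fin K → ℝ) (γ ω : Fin K → EuclideanSpace ℝ (Fin d))
    {h : EuclideanSpace ℝ (Fin d) → ℝ} {v : EuclideanSpace ℝ (Fin d) → H}
    (hv : ∀ s t, ⟪v s, v t⟫_ℝ = h (s - t)) (s t : EuclideanSpace ℝ (Fin d)) :
    ⟪spectralFamily σ γ ω v s, spectralFamily σ γ ω v t⟫_ℝ = gsk h σ γ ω (s - t) := by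
  rw [PiLp.inner_apply, gsk]
  refine Finset.sum_congr rfl fun k _ => ?_
  simp only [spectralFamily, real_inner_smul_left, real_inner_smul_right, inner_modulation, hv,
    hprod_sub_left]
  ring

theorem contDiff_spectralFamily_iff {σ : Fin K → ℝ} {γ : Fin K → EuclideanSpace ℝ (Fin d)}
    {k : Fin K} (hσ : σ k ≠ 0) (hγ : ∀ j, γ k j ≠ 0) (ω : Fin K → EuclideanSpace ℝ (Fin d))
    {v : EuclideanSpace ℝ (Fin d) → H} {n : WithTop ℕ∞} :
    ContDiff ℝ n (spectralFamily σ γ ω v) ↔ ContDiff ℝ n v := by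
  rw [contDiff_piLp]
  refine ⟨fun hw => ?_, fun hv l =>
    ((contDiff_modulation_iff (ω l)).2 (contDiff_comp_hprod hv (γ l))).const_smul (σ l)⟩
  have hmodulation := (hw k).const_smul (σ k)⁻¹
  simp only [spectralFamily, inv_smul_smul₀ hσ] at hmodulation
  exact (contDiff_comp_hprod_iff hγ).1 ((contDiff_modulation_iff (ω k)).1 hmodulation)

end SpectralFamily

end SpectralKernel

open SpectralKernel in
theorem proposition1_general {d K : ℕ} (h : EuclideanSpace ℝ (Fin d) → ℝ) (σ : Fin K → ℝ)
    (γ ω : Fin K → EuclideanSpace ℝ (Fin d)) {k : Fin K} (hσ : σ k ≠ 0) (hγ : ∀ j, γ k j ≠ 0)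
    {Ω : Type*} [MeasurableSpace Ω] (P : Measure Ω) (X : EuclideanSpace ℝ (Fin d) → Ω → ℝ)
    (hX : ∀ t, MemLp (X t) 2 P)
    (hX_gram : ∀ s t, ∫ a, X s a * X t a ∂P = gsk h σ γ ω (s - t))
    {Ω' : Type*} [MeasurableSpace Ω'] (P' : Measure Ω') (Y : EuclideanSpace ℝ (Fin d) → Ω' → ℝ)
    (hY : ∀ t, MemLp (Y t) 2 P') (hY_gram : ∀ s t, ∫ a, Y s a * Y t a ∂P' = h (s - t)) (p : ℕ) :
    IsMSContDiff P p X ↔ IsMSContDiff P' p Y := by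
  have hX_inner : ∀ s t, ⟪(hX s).toLp (X s), (hX t).toLp (X t)⟫_ℝ = gsk h σ γ ω (s - t) :=
    fun s t => by simp only [inner_toLp, ← hX_gram, RCLike.inner_apply', conj_trivial]
  have hY_inner : ∀ s t, ⟪(hY s).toLp (Y s), (hY t).toLp (Y t)⟫_ℝ = h (s - t) :=
    fun s t => by simp only [inner_toLp, ← hY_gram, RCLike.inner_apply', conj_trivial]
  rw [isMSContDiff_iff_contDiff_toLp p hX, isMSContDiff_iff_contDiff_toLp p hY,
    ← contDiff_spectralFamily_iff hσ hγ ω (v := fun t => (hY t).toLp (Y t))]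
  exact contDiff_iff_of_inner_eq (fun s t => (hX_inner s t).trans
    (inner_spectralFamily σ γ ω hY_inner s t).symm) p

theorem proposition1 {d K : ℕ} (hK : 0 < K)
    (h : EuclideanSpace ℝ (Fin d) → ℝ)
    (h_psd : SpectralKernel.IsPSDFunction h) (h_cont : Continuous h)
    (h_int : Integrable h volume) (h_pos : ∀ τ, 0 < h τ) (h_zero : h 0 = 1)
    (σ : Fin K → ℝ) (hσ : ∀ k, 0 < σ k)
    (γ ω : Fin K → EuclideanSpace ℝ (Fin d)) (hγ : ∀ k j, 0 < γ k j)
    {Ω : Type*} [MeasurableSpace Ω] (P : Measure Ω) [IsProbabilityMeasure P]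
    (X : EuclideanSpace ℝ (Fin d) → Ω → ℝ)
    (hX : SpectralKernel.IsStationaryGP X (SpectralKernel.gsk h σ γ ω) P)
    {Ω' : Type*} [MeasurableSpace Ω'] (P' : Measure Ω') [IsProbabilityMeasure P']
    (Y : EuclideanSpace ℝ (Fin d) → Ω' → ℝ)
    (hY : SpectralKernel.IsStationaryGP Y h P')
    (p : ℕ) :
    SpectralKernel.IsMSContDiff P p X ↔ SpectralKernel.IsMSContDiff P' p Y := by
  exact proposition1_general h σ γ ω (hσ ⟨0, hK⟩).ne' (fun j => (hγ ⟨0, hK⟩ j).ne') P X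
    hX.memLp_two hX.integral_mul P' Y hY.memLp_two hY.integral_mul p
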